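/- Let $n,d\ge 0$ and $\ell\ge 1$ be integers, and let $f:\{\pm1\}^n\to[-1,1]$. For $S\subseteq[n]$ write $\chi_S(x)=\prod_{j\in S}x_j$, and let $\hat f(S)$ be the Fourier coefficients of $f$, i.e. the unique real numbers with $f(x)=\sum_{S\subseteq[n]}\hat f(S)\,\chi_S(x)$ for all $x\in\{\pm1\}^n$. Suppose that $f$ has degree at most $d$, that is, $\hat f(S)=0$ whenever $|S|>d$. Then $$\|\hat f_\ell\|_1:=\sum_{S\subseteq[n],\,|S|=\ell}|\hat f(S)|\;\le\; n^{\frac{\ell-1}{2}}\cdot d^{\ell}\cdot e^{\binom{\ell+1}{2}}.$$ -/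

import Mathlib

namespace BooleanCube

/-- The discrete cube `{±1}^n`; the units of `ℤ` are exactly `1` and `-1`. -/
abbrev Cube (n : ℕ) : Type := Fin n → ℤˣ

/-- The character `χ_S(x) = ∏_{j ∈ S} x_j`, as a real number. -/
def chi {n : ℕ} (S : Finset (Fin n)) (x : Cube n) : ℝ :=
  ∏ j ∈ S, (((x j : ℤˣ) : ℤ) : ℝ)

/-- The Fourier coefficient `f̂(S) = 𝔼[f(X) χ_S(X)]`, with `X` uniform on `{±1}^n`.
By `sum_fourierCoeff_mul_chi` and `fourierCoeff_unique` below, these are the coefficients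
of the unique expansion of `f` in the characters. -/
noncomputable def fourierCoeff {n : ℕ} (f : Cube n → ℝ) (S : Finset (Fin n)) : ℝ :=
  (∑ x : Cube n, f x * chi S x) / 2 ^ n

/-- The degree of `f`, i.e. the degree of its multilinear polynomial: the largest `|S|` with
`f̂(S) ≠ 0` (and `0` for `f = 0`). -/
noncomputable def degree {n : ℕ} (f : Cube n → ℝ) : ℕ :=
  sSup {k : ℕ | ∃ S : Finset (Fin n), fourierCoeff f S ≠ 0 ∧ S.card = k}

/-- The level-`ℓ` Fourier `ℓ₁`-norm `‖f̂_ℓ‖₁ = ∑_{|S| = ℓ} |f̂(S)|`. -/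
noncomputable def levelL1Norm {n : ℕ} (f : Cube n → ℝ) (l : ℕ) : ℝ :=
  ∑ S ∈ (Finset.univ : Finset (Fin n)).powersetCard l, |fourierCoeff f S|

theorem sum_chi_mul_chi {n : ℕ} (S T : Finset (Fin n)) :
    ∑ x : Cube n, chi S x * chi T x = if S = T then 2 ^ n else 0 := by
  have h : ∀ x : Cube n, chi S x * chi T x =
      ∏ i, ((if i ∈ S then (((x i : ℤˣ) : ℤ) : ℝ) else 1) *
        (if i ∈ T then (((x i : ℤˣ) : ℤ) : ℝ) else 1)) := by
    intro x
    rw [Finset.prod_mul_distrib]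
    simp [chi, Finset.prod_ite_mem]
  have hu : (Finset.univ : Finset ℤˣ) = {1, -1} := rfl
  have e := Finset.prod_univ_sum (fun _ : Fin n => (Finset.univ : Finset ℤˣ))
    (fun i u => (if i ∈ S then ((u : ℤ) : ℝ) else 1) * (if i ∈ T then ((u : ℤ) : ℝ) else 1))
  rw [Fintype.piFinset_univ] at e
  rw [Finset.sum_congr rfl fun x _ => h x, ← e]
  split_ifs with hST
  · subst hST
    rw [Finset.prod_congr rfl (g := fun _ => (2 : ℝ))]
    · simp
    · intro i _
      by_cases hi : i ∈ S <;> simp [hu, hi] <;> norm_num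
  · obtain ⟨i, hi⟩ : ∃ i, ¬ (i ∈ S ↔ i ∈ T) := by
      by_contra! hc
      exact hST (Finset.ext hc)
    apply Finset.prod_eq_zero (Finset.mem_univ i)
    by_cases hS : i ∈ S <;> by_cases hT : i ∈ T <;> simp_all

theorem fourierCoeff_unique {n : ℕ} (f : Cube n → ℝ) (c : Finset (Fin n) → ℝ)
    (h : ∀ x, f x = ∑ S, c S * chi S x) (T : Finset (Fin n)) : fourierCoeff f T = c T := by
  have : ∑ x : Cube n, f x * chi T x = c T * 2 ^ n := by
    simp_rw [h, Finset.sum_mul]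
    rw [Finset.sum_comm]
    simp_rw [mul_assoc, ← Finset.mul_sum, sum_chi_mul_chi]
    simp
  rw [fourierCoeff, this]
  field_simp

theorem sum_fourierCoeff_mul_chi {n : ℕ} (f : Cube n → ℝ) (x : Cube n) :
    f x = ∑ S, fourierCoeff f S * chi S x := by
  have key : ∀ y : Cube n, ∑ S, chi S y * chi S x = if y = x then 2 ^ n else 0 := by
    intro y
    have h : ∑ S, chi S y * chi S x =
        ∏ i, (1 + (((y i : ℤˣ) : ℤ) : ℝ) * (((x i : ℤˣ) : ℤ) : ℝ)) := by
      rw [Finset.prod_one_add]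
      simp [chi, Finset.prod_mul_distrib]
    rw [h]
    split_ifs with hy
    · subst hy
      rw [Finset.prod_congr rfl (g := fun _ => (2 : ℝ))]
      · simp
      · intro i _
        rcases Int.units_eq_one_or (y i) with hi | hi <;> simp [hi] <;> norm_num
    · obtain ⟨i, hi⟩ := Function.ne_iff.mp hy
      apply Finset.prod_eq_zero (Finset.mem_univ i)
      rcases Int.units_eq_one_or (y i) with h1 | h1 <;>
        rcases Int.units_eq_one_or (x i) with h2 | h2 <;> simp_all
  simp_rw [fourierCoeff, div_mul_eq_mul_div, Finset.sum_mul]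
  rw [← Finset.sum_div, Finset.sum_comm]
  simp_rw [mul_assoc, ← Finset.mul_sum, key]
  simp

theorem degree_le_iff {n : ℕ} (f : Cube n → ℝ) (d : ℕ) :
    degree f ≤ d ↔ ∀ S : Finset (Fin n), d < S.card → fourierCoeff f S = 0 := by
  have hb : BddAbove {k : ℕ | ∃ S : Finset (Fin n), fourierCoeff f S ≠ 0 ∧ S.card = k} := by
    refine ⟨n, ?_⟩
    rintro k ⟨S, -, rfl⟩
    simpa using Finset.card_le_univ S
  constructor
  · intro h S hS
    by_contra hne
    have : S.card ≤ degree f := le_csSup hb ⟨S, hne, rfl⟩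
    omega
  · intro h
    apply csSup_le'
    rintro k ⟨S, hS, rfl⟩
    by_contra hk
    exact hS (h S (by omega))

end BooleanCube

/-! Let `c` be the linear coefficient of a real polynomial `p`. The Bernstein inequality at the
origin, `|c| ≤ deg p · sup_{[-1, 1]} |p|`, follows from the Markov inequality at an endpoint: the
square of the odd part of `p` is a polynomial in `u²` with linear coefficient `c²`, and it maps
`[0, 1]` into itself if `|p| ≤ 1` on `[-1, 1]`.

The level norms are bounded by induction on the level. Let `f̃` be the multilinear extension of `f`.
Restricted to a cube with centre `r x` and half side `ρ`, where `|r| + ρ ≤ 1`, it is again a bounded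
function of degree at most `d`, with Fourier coefficients `ρ^|T| ∂_T f̃(r x)`. The bound for level
`l` thus controls `∑_{|T| = l} |∂_T f̃(r x)|` for `|r| ≤ 1 - ρ`, and the Bernstein inequality in
`r` turns this into a bound on `∑_{|T| = l} |∑_{j ∉ T} f̂(T ∪ {j}) x_j|` for every sign vector `x`.
Averaging over `x` and testing each linear form against a Riesz product recovers the sum of the
`|f̂(T ∪ {j})|`, at the price of a factor `√(n e)`. -/

open Finset Polynomial
open scoped BigOperators

theorem exists_unit_mul_eq_abs (a : ℝ) : ∃ u : ℤˣ, (u : ℤ) * a = |a| := by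
  rcases abs_choice a with h | h
  · exact ⟨1, by simp [h]⟩
  · exact ⟨-1, by simp [h]⟩

section Bernstein

theorem sub_comp_neg_X_eq_two_mul_X_mul_expand {R : Type*} [CommRing R] (p : R[X]) :
    p - p.comp (-X) = 2 * X * expand R 2 (contract 2 p.divX) := by
  ext n
  rw [show (-X : R[X]) = C (-1) * X by simp, coeff_sub, comp_C_mul_X_coeff, mul_assoc,
    coeff_ofNat_mul]
  cases n with
  | zero => simp
  | succ m =>
    rw [coeff_X_mul, coeff_expand two_pos]
    rcases Nat.even_or_odd m with hm | hm
    · rw [if_pos hm.two_dvd, coeff_contract two_ne_zero, Nat.div_mul_cancel hm.two_dvd, coeff_divX,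
        hm.add_one.neg_one_pow]
      ring
    · rw [if_neg hm.not_two_dvd_nat, hm.add_one.neg_one_pow]
      ring

theorem natDegree_contract_le {R : Type*} [CommSemiring R] {k : ℕ} (hk : k ≠ 0) (p : R[X]) :
    (contract k p).natDegree ≤ p.natDegree / k := by
  refine natDegree_le_iff_coeff_eq_zero.mpr fun m hm => ?_
  rw [coeff_contract hk]
  exact coeff_eq_zero_of_natDegree_lt ((Nat.div_lt_iff_lt_mul (Nat.pos_of_ne_zero hk)).mp hm)

theorem coeff_one_le_sq_of_eval_mem_Icc {q : ℝ[X]} {d : ℕ} (hq : q.natDegree ≤ d)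
    (hmaps : ∀ y ∈ Set.Icc (0 : ℝ) 1, q.eval y ∈ Set.Icc (0 : ℝ) 1) : q.coeff 1 ≤ d ^ 2 := by
  set P : ℝ[X] := 1 - C 2 * q.comp (C (1 / 2) * (1 - X)) with hP
  have hdeg : P.natDegree ≤ d := by
    have hlin : (C (1 / 2) * (1 - X) : ℝ[X]).natDegree ≤ 1 := by compute_degree
    have hcomp : (q.comp (C (1 / 2) * (1 - X))).natDegree ≤ d :=
      natDegree_comp_le.trans ((Nat.mul_le_mul hq hlin).trans_eq (mul_one d))
    exact natDegree_sub_le_iff_left ((natDegree_C_mul_le _ _).trans hcomp) |>.mpr (by simp)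
  have hbound : ∀ u ∈ Set.Icc (-1 : ℝ) 1, |P.eval u| ≤ 1 := by
    rintro u ⟨hu, hu'⟩
    have := hmaps (1 / 2 * (1 - u)) ⟨by linarith, by linarith⟩
    simp only [hP, eval_sub, eval_one, eval_mul, eval_comp, eval_C, eval_X]
    rw [abs_le]
    constructor <;> linarith [this.1, this.2]
  have hderiv : P.derivative.eval 1 = q.coeff 1 := by
    simp [hP, derivative_comp, ← coeff_zero_eq_eval_zero, coeff_derivative]
  have hmarkov := Chebyshev.eval_iterate_derivative_le_of_forall_abs_le_one (k := 1) le_rfl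
    (natDegree_le_iff_degree_le.mp hdeg) hbound
  simpa [hderiv, Chebyshev.derivative_T_eval_one] using hmarkov

theorem abs_coeff_one_le_of_abs_eval_le_one {p : ℝ[X]} {d : ℕ} (hp : p.natDegree ≤ d)
    (hbound : ∀ u ∈ Set.Icc (-1 : ℝ) 1, |p.eval u| ≤ 1) : |p.coeff 1| ≤ d := by
  rcases Nat.eq_zero_or_pos d with rfl | hd
  · simp [coeff_eq_zero_of_natDegree_lt (hp.trans_lt one_pos)]
  set s := contract 2 p.divX with hs
  have hdeg : (X * s ^ 2).natDegree ≤ d := by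
    have hdivX := natDegree_divX_eq_natDegree_tsub_one (p := p)
    have hcontract : s.natDegree ≤ _ := natDegree_contract_le two_ne_zero p.divX
    have hmul : (X * s ^ 2).natDegree ≤ 1 + 2 * s.natDegree :=
      natDegree_mul_le_of_le natDegree_X_le natDegree_pow_le
    omega
  have hsq (u : ℝ) : (X * s ^ 2).eval (u ^ 2) = ((p.eval u - p.eval (-u)) / 2) ^ 2 := by
    have hodd := congrArg (eval u) (sub_comp_neg_X_eq_two_mul_X_mul_expand p)
    simp only [eval_sub, eval_comp, eval_neg, eval_X, eval_mul, eval_ofNat, expand_eval,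
      ← hs] at hodd
    rw [hodd, eval_mul, eval_X, eval_pow]
    ring
  have hmaps : ∀ y ∈ Set.Icc (0 : ℝ) 1, (X * s ^ 2).eval y ∈ Set.Icc (0 : ℝ) 1 := by
    rintro y ⟨hy, hy'⟩
    have hu : √y ∈ Set.Icc (-1 : ℝ) 1 :=
      ⟨by linarith [Real.sqrt_nonneg y], Real.sqrt_le_one.mpr hy'⟩
    have hpos := abs_le.mp (hbound (√y) hu)
    have hneg := abs_le.mp (hbound (-√y) ⟨neg_le_neg hu.2, neg_le.mp hu.1⟩)
    rw [← Real.sq_sqrt hy, hsq]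
    exact ⟨sq_nonneg _, (sq_le_one_iff_abs_le_one _).mpr
      (abs_le.mpr ⟨by linarith, by linarith⟩)⟩
  have hcoeff : (X * s ^ 2).coeff 1 = p.coeff 1 ^ 2 := by
    simp [sq, mul_coeff_zero, hs, coeff_contract]
  exact abs_le_of_sq_le_sq (hcoeff ▸ coeff_one_le_sq_of_eval_mem_Icc hdeg hmaps) d.cast_nonneg

theorem abs_coeff_one_le_mul_of_abs_eval_le {p : ℝ[X]} {d : ℕ} {M : ℝ} (hp : p.natDegree ≤ d)
    (hbound : ∀ u ∈ Set.Icc (-1 : ℝ) 1, |p.eval u| ≤ M) : |p.coeff 1| ≤ d * M := by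
  rcases ((abs_nonneg _).trans (hbound 0 (by norm_num))).eq_or_lt with rfl | hM
  · have hroot : Set.Icc (-1 : ℝ) 1 ⊆ {u | p.IsRoot u} := fun u hu => by simpa using hbound u hu
    simp [eq_zero_of_infinite_isRoot p ((Set.Icc_infinite (by norm_num)).mono hroot)]
  · have h := abs_coeff_one_le_of_abs_eval_le_one (p := C M⁻¹ * p)
      ((natDegree_C_mul_le _ _).trans hp) fun u hu => by
        rw [eval_mul, eval_C, abs_mul, abs_of_pos (inv_pos.mpr hM), inv_mul_le_one₀ hM]
        exact hbound u hu
    rwa [coeff_C_mul, abs_mul, abs_of_pos (inv_pos.mpr hM), inv_mul_le_iff₀ hM, mul_comm] at h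

theorem mul_sum_abs_coeff_one_le_mul_of_sum_abs_eval_le {ι : Type*} {s : Finset ι}
    {p : ι → ℝ[X]} {d : ℕ} {a M : ℝ} (ha : 0 ≤ a) (hp : ∀ i ∈ s, (p i).natDegree ≤ d)
    (hbound : ∀ r, |r| ≤ a → ∑ i ∈ s, |(p i).eval r| ≤ M) :
    a * ∑ i ∈ s, |(p i).coeff 1| ≤ d * M := by
  choose ε hε using fun i => exists_unit_mul_eq_abs ((p i).coeff 1)
  set q : ℝ[X] := ∑ i ∈ s, C ((ε i : ℤ) : ℝ) * p i with hq
  have hcoeff : (q.comp (C a * X)).coeff 1 = a * ∑ i ∈ s, |(p i).coeff 1| := by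
    simp_rw [comp_C_mul_X_coeff, hq, finsetSum_coeff, coeff_C_mul, hε, pow_one, mul_comm]
  have hdeg : (q.comp (C a * X)).natDegree ≤ d := by
    have hdegq : q.natDegree ≤ d := natDegree_sum_le_of_forall_le _ _ fun i hi =>
      (natDegree_C_mul_le _ _).trans (hp i hi)
    refine natDegree_comp_le.trans ((Nat.mul_le_mul hdegq ?_).trans_eq (mul_one d))
    exact (natDegree_C_mul_le _ _).trans natDegree_X_le
  rw [← hcoeff]
  refine (le_abs_self _).trans (abs_coeff_one_le_mul_of_abs_eval_le hdeg fun u hu => ?_)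
  have hau : |a * u| ≤ a := by
    rw [abs_mul, abs_of_nonneg ha]
    exact mul_le_of_le_one_right ha (abs_le.mpr hu)
  calc |(q.comp (C a * X)).eval u| = |∑ i ∈ s, (ε i : ℤ) * (p i).eval (a * u)| := by
        simp [hq, eval_finsetSum]
    _ ≤ ∑ i ∈ s, |(ε i : ℤ) * (p i).eval (a * u)| := abs_sum_le_sum_abs _ _
    _ = ∑ i ∈ s, |(p i).eval (a * u)| := by simp [abs_mul, abs_unit_intCast]
    _ ≤ M := hbound _ hau

end Bernstein

section RandomSigns

variable {ι : Type*} [Fintype ι]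

/-- The Riesz product `∏ k, (1 + i b_k x_k)`, the kernel dual to linear forms in signs: its
linear Fourier coefficients are `i b_k` and its modulus is bounded in terms of `∑ k, b_k ^ 2`. -/
noncomputable def rieszProduct (b : ι → ℝ) (x : ι → ℤˣ) : ℂ :=
  ∏ k, (1 + b k * (x k : ℤ) * Complex.I)

theorem norm_rieszProduct_le (b : ι → ℝ) (x : ι → ℤˣ) :
    ‖rieszProduct b x‖ ≤ Real.exp ((∑ k, b k ^ 2) / 2) := by
  rw [rieszProduct, norm_prod, sum_div, Real.exp_sum]
  refine prod_le_prod (fun _ _ => norm_nonneg _) fun k _ => ?_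
  have hnorm : ‖1 + b k * (x k : ℤ) * Complex.I‖ ^ 2 = b k ^ 2 + 1 := by
    rw [Complex.sq_norm, Complex.normSq_apply]
    rcases Int.units_eq_one_or (x k) with h | h <;> simp [h] <;> ring
  refine le_of_sq_le_sq ?_ (Real.exp_pos _).le
  rw [hnorm, ← Real.exp_nat_mul, Nat.cast_ofNat, mul_div_cancel₀ _ two_ne_zero]
  exact Real.add_one_le_exp _

variable [DecidableEq ι]

theorem expect_prod_eq_prod_expect {α K : Type*} [Fintype α] [Semifield K] [CharZero K]
    (g : ι → α → K) : 𝔼 x : ι → α, ∏ i, g i (x i) = ∏ i, 𝔼 u, g i u := by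
  simp_rw [Fintype.expect_eq_sum_div_card, prod_div_distrib, Fintype.prod_sum, Fintype.card_pi,
    Nat.cast_prod]

theorem expect_intUnits {K : Type*} [Semifield K] [CharZero K] (g : ℤˣ → K) :
    𝔼 u, g u = (g 1 + g (-1)) / 2 := by
  have huniv : (univ : Finset ℤˣ) = {1, -1} := rfl
  rw [Fintype.expect_eq_sum_div_card, huniv, sum_pair (by decide), Fintype.card_units_int,
    Nat.cast_ofNat]

theorem expect_coord_mul_rieszProduct (b : ι → ℝ) (j : ι) :
    𝔼 x : ι → ℤˣ, (x j : ℤ) * rieszProduct b x = b j * Complex.I := by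
  have hprod (x : ι → ℤˣ) : (x j : ℤ) * rieszProduct b x =
      ∏ k, (if k = j then ((x k : ℤ) : ℂ) else 1) * (1 + b k * (x k : ℤ) * Complex.I) := by
    rw [prod_mul_distrib, Fintype.prod_ite_eq' j, rieszProduct]
  have hfactor (k : ι) :
      𝔼 u : ℤˣ, (if k = j then ((u : ℤ) : ℂ) else 1) * (1 + b k * (u : ℤ) * Complex.I) =
        if k = j then b k * Complex.I else 1 := by
    rw [expect_intUnits]
    split_ifs <;> push_cast <;> ring
  simp_rw [hprod, expect_prod_eq_prod_expect fun k (u : ℤˣ) =>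
    (if k = j then ((u : ℤ) : ℂ) else 1) * (1 + b k * (u : ℤ) * Complex.I), hfactor]
  exact Fintype.prod_ite_eq' j _

theorem abs_sum_mul_le_exp_mul_expect (a b : ι → ℝ) :
    |∑ j, a j * b j| ≤
      Real.exp ((∑ j, b j ^ 2) / 2) * 𝔼 x : ι → ℤˣ, |∑ j, a j * (x j : ℤ)| := by
  have hdual : 𝔼 x : ι → ℤˣ, ((∑ j, a j * (x j : ℤ) : ℝ) : ℂ) * rieszProduct b x =
      (∑ j, a j * b j : ℝ) * Complex.I := by
    push_cast
    simp_rw [sum_mul, mul_assoc, ← expect_coord_mul_rieszProduct b, mul_expect]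
    exact expect_sum_comm _ _ _
  calc |∑ j, a j * b j| = ‖((∑ j, a j * b j : ℝ) : ℂ) * Complex.I‖ := by
        rw [norm_mul, Complex.norm_I, mul_one, Complex.norm_real, Real.norm_eq_abs]
    _ ≤ 𝔼 x : ι → ℤˣ, ‖((∑ j, a j * (x j : ℤ) : ℝ) : ℂ) * rieszProduct b x‖ := by
        rw [← hdual]
        exact RCLike.norm_expect_le (K := ℂ)
    _ ≤ 𝔼 x : ι → ℤˣ, Real.exp ((∑ j, b j ^ 2) / 2) * |∑ j, a j * (x j : ℤ)| := by
        refine expect_le_expect fun x _ => ?_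
        rw [norm_mul, Complex.norm_real, Real.norm_eq_abs, mul_comm]
        exact mul_le_mul_of_nonneg_right (norm_rieszProduct_le b x) (abs_nonneg _)
    _ = _ := (mul_expect _ _ _).symm

theorem sum_abs_le_sqrt_card_mul_expect (a : ι → ℝ) :
    ∑ j, |a j| ≤ √(Fintype.card ι) * Real.exp (1 / 2) *
      𝔼 x : ι → ℤˣ, |∑ j, a j * (x j : ℤ)| := by
  rcases isEmpty_or_nonempty ι with hι | hι
  · simp
  have hcard : 0 < √(Fintype.card ι : ℝ) := by positivity
  choose ε hε using fun j => exists_unit_mul_eq_abs (a j)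
  have h := abs_sum_mul_le_exp_mul_expect a fun j => (ε j : ℤ) / √(Fintype.card ι)
  have hsq : ∑ j, (((ε j : ℤ) : ℝ) / √(Fintype.card ι)) ^ 2 = 1 := by
    have hε2 (j : ι) : ((ε j : ℤ) : ℝ) ^ 2 = 1 := by rw [← sq_abs, abs_unit_intCast, one_pow]
    simp [div_pow, hε2]
  have hsum : ∑ j, a j * (((ε j : ℤ) : ℝ) / √(Fintype.card ι)) =
      (∑ j, |a j|) / √(Fintype.card ι) := by
    rw [sum_div]
    exact sum_congr rfl fun j _ => by rw [← hε]; ring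
  rw [hsum, hsq, abs_of_nonneg (by positivity), div_le_iff₀' hcard] at h
  rwa [mul_assoc]

theorem sum_finset_abs_le_sqrt_card_mul_expect (s : Finset ι) (a : ι → ℝ) :
    ∑ j ∈ s, |a j| ≤ √(Fintype.card ι) * Real.exp (1 / 2) *
      𝔼 x : ι → ℤˣ, |∑ j ∈ s, a j * (x j : ℤ)| := by
  simpa [apply_ite, ite_mul] using sum_abs_le_sqrt_card_mul_expect fun j => if j ∈ s then a j else 0

end RandomSigns

theorem sum_powersetCard_sum_insert {α M : Type*} [DecidableEq α] [AddCommMonoid M] (s : Finset α)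
    (l : ℕ) (a : Finset α → M) :
    ∑ T ∈ s.powersetCard l, ∑ j ∈ s \ T, a (insert j T) =
      (l + 1) • ∑ S ∈ s.powersetCard (l + 1), a S := by
  have hcount : (l + 1) • ∑ S ∈ s.powersetCard (l + 1), a S =
      ∑ S ∈ s.powersetCard (l + 1), ∑ _j ∈ S, a S := by
    rw [smul_sum]
    exact sum_congr rfl fun S hS => by rw [sum_const, (mem_powersetCard.mp hS).2]
  rw [hcount, sum_sigma', sum_sigma']
  refine sum_bij' (fun p _ => ⟨insert p.2 p.1, p.2⟩) (fun p _ => ⟨p.1.erase p.2, p.2⟩)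
    ?_ ?_ ?_ ?_ fun _ _ => rfl
  all_goals
    rintro ⟨T, j⟩ h
    simp only [mem_sigma, mem_powersetCard, mem_sdiff] at h ⊢
  · grind
  · grind
  · rw [erase_insert h.2.2]
  · rw [insert_erase h.2]

theorem exp_neg_one_le_div_succ_pow (l : ℕ) : Real.exp (-1) ≤ ((l : ℝ) / (l + 1)) ^ l := by
  rcases Nat.eq_zero_or_pos l with rfl | hl
  · simp
  have hl' : (0 : ℝ) < l := Nat.cast_pos.mpr hl
  have h : ((l + 1) / l : ℝ) ^ l ≤ Real.exp 1 :=
    calc ((l + 1) / l : ℝ) ^ l ≤ Real.exp (1 / l) ^ l := by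
          gcongr
          rw [add_div, div_self hl'.ne', add_comm]
          exact Real.add_one_le_exp _
      _ = Real.exp 1 := by rw [← Real.exp_nat_mul, mul_one_div_cancel hl'.ne']
  rw [Real.exp_neg, ← inv_div, inv_pow]
  gcongr

theorem three_halves_mul_pred_le_choose_two (l : ℕ) : 3 / 2 * ((l : ℝ) - 1) ≤ (l + 1).choose 2 := by
  rw [Nat.cast_choose_two]
  push_cast
  linarith [sq_nonneg ((l : ℝ) - 1)]

namespace BooleanCube

variable {n d l : ℕ} {f : Cube n → ℝ} {B : ℝ}

theorem fourierCoeff_eq_expect (f : Cube n → ℝ) (S : Finset (Fin n)) :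
    fourierCoeff f S = 𝔼 x, f x * chi S x := by
  simp [fourierCoeff, Fintype.expect_eq_sum_div_card]

/-- The multilinear polynomial of `f`, as a function on `ℝⁿ`. -/
noncomputable def multilinearExt (f : Cube n → ℝ) (z : Fin n → ℝ) : ℝ :=
  ∑ S, fourierCoeff f S * ∏ j ∈ S, z j

theorem multilinearExt_eq_expect (f : Cube n → ℝ) (z : Fin n → ℝ) :
    multilinearExt f z = 𝔼 y : Cube n, f y * ∏ j, (1 + z j * (y j : ℤ)) := by
  simp_rw [multilinearExt, fourierCoeff_eq_expect, expect_mul, ← expect_sum_comm, prod_one_add,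
    powerset_univ, mul_sum, prod_mul_distrib, chi]
  exact expect_congr rfl fun y _ => sum_congr rfl fun S _ => by ring

theorem abs_multilinearExt_le (hf : ∀ x, |f x| ≤ B) {z : Fin n → ℝ} (hz : ∀ j, |z j| ≤ 1) :
    |multilinearExt f z| ≤ B := by
  have hweight (y : Cube n) : 0 ≤ ∏ j, (1 + z j * (y j : ℤ)) := prod_nonneg fun j _ => by
    have hzy : |z j * (y j : ℤ)| ≤ 1 := by rw [abs_mul, abs_unit_intCast, mul_one]; exact hz j
    linarith [neg_le_of_abs_le hzy]
  have htotal : 𝔼 y : Cube n, ∏ j, (1 + z j * (y j : ℤ)) = 1 := by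
    rw [expect_prod_eq_prod_expect fun j (u : ℤˣ) => 1 + z j * (u : ℤ)]
    refine prod_eq_one fun j _ => ?_
    rw [expect_intUnits]
    push_cast
    ring
  calc |multilinearExt f z| ≤ 𝔼 y : Cube n, |f y * ∏ j, (1 + z j * (y j : ℤ))| := by
        rw [multilinearExt_eq_expect]
        exact abs_expect_le _ _
    _ ≤ 𝔼 y : Cube n, B * ∏ j, (1 + z j * (y j : ℤ)) := by
        refine expect_le_expect fun y _ => ?_
        rw [abs_mul, abs_of_nonneg (hweight y)]
        exact mul_le_mul_of_nonneg_right (hf y) (hweight y)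
    _ = B := by rw [← mul_expect, htotal, mul_one]

/-- The polynomial `r ↦ ∂_T f̃(r x)`, where `f̃` is the multilinear extension of `f` and `∂_T` is
the mixed partial derivative along the coordinates in `T`. -/
noncomputable def linePoly (f : Cube n → ℝ) (T : Finset (Fin n)) (x : Cube n) : ℝ[X] :=
  ∑ S with T ⊆ S, monomial (S \ T).card (fourierCoeff f S * chi (S \ T) x)

theorem natDegree_linePoly_le (hd : degree f ≤ d) (T : Finset (Fin n)) (x : Cube n) :
    (linePoly f T x).natDegree ≤ d := by
  refine natDegree_sum_le_of_forall_le _ _ fun S _ => ?_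
  by_cases hS : d < S.card
  · rw [(degree_le_iff f d).mp hd S hS, zero_mul, monomial_zero_right, natDegree_zero]
    exact d.zero_le
  · exact (natDegree_monomial_le _).trans ((card_le_card sdiff_subset).trans (not_lt.mp hS))

theorem coeff_one_linePoly (f : Cube n → ℝ) (T : Finset (Fin n)) (x : Cube n) :
    (linePoly f T x).coeff 1 = ∑ j ∈ univ \ T, fourierCoeff f (insert j T) * (x j : ℤ) := by
  simp_rw [linePoly, finsetSum_coeff, coeff_monomial]
  rw [← sum_filter, filter_filter]
  symm
  refine sum_bij (fun j _ => insert j T) ?_ ?_ ?_ ?_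
  · intro j hj
    simp only [mem_sdiff, mem_univ, true_and] at hj
    simp [insert_sdiff_of_notMem _ hj]
  · intro i hi j _ h
    have : i ∈ insert j T := h ▸ mem_insert_self i T
    exact (mem_insert.mp this).resolve_right (mem_sdiff.mp hi).2
  · intro S hS
    obtain ⟨hTS, hcard⟩ := (mem_filter.mp hS).2
    obtain ⟨j, hj⟩ := card_eq_one.mp hcard
    have hjST : j ∈ S \ T := hj ▸ mem_singleton_self j
    refine ⟨j, by simpa using (mem_sdiff.mp hjST).2, ?_⟩
    rw [insert_eq, ← hj, sdiff_union_of_subset hTS]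
  · intro j hj
    simp [insert_sdiff_of_notMem _ (mem_sdiff.mp hj).2, chi]

theorem mul_levelL1Norm_succ_le_expect (f : Cube n → ℝ) (l : ℕ) :
    (l + 1) * levelL1Norm f (l + 1) ≤ √n * Real.exp (1 / 2) *
      𝔼 x, ∑ T ∈ univ.powersetCard l, |(linePoly f T x).coeff 1| := by
  have hcount := sum_powersetCard_sum_insert univ l fun S => |fourierCoeff f S|
  rw [nsmul_eq_mul, Nat.cast_add_one] at hcount
  rw [levelL1Norm, ← hcount, expect_sum_comm, mul_sum]
  refine sum_le_sum fun T _ => ?_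
  simpa only [coeff_one_linePoly, Fintype.card_fin] using
    sum_finset_abs_le_sqrt_card_mul_expect (univ \ T) fun j => fourierCoeff f (insert j T)

/-- The multilinear extension of `f` on the cube with centre `r x` and half side `ρ`, rescaled to
a function on the discrete cube. -/
noncomputable def recentre (f : Cube n → ℝ) (x : Cube n) (r ρ : ℝ) : Cube n → ℝ := fun y =>
  multilinearExt f fun j => ρ * (y j : ℤ) + r * (x j : ℤ)

theorem fourierCoeff_recentre (f : Cube n → ℝ) (x : Cube n) (r ρ : ℝ) (T : Finset (Fin n)) :
    fourierCoeff (recentre f x r ρ) T = ρ ^ T.card * (linePoly f T x).eval r := by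
  refine fourierCoeff_unique _ (fun T => ρ ^ T.card * (linePoly f T x).eval r) (fun y => ?_) T
  simp_rw [recentre, multilinearExt, prod_add, prod_mul_distrib, prod_const, linePoly,
    eval_finsetSum, eval_monomial, mul_sum, sum_mul, sum_filter]
  rw [sum_comm]
  refine sum_congr rfl fun S _ => ?_
  rw [← sum_filter, filter_subset_univ]
  exact sum_congr rfl fun T _ => by simp only [chi]; ring

theorem abs_recentre_le (hf : ∀ x, |f x| ≤ B) (x : Cube n) {r ρ : ℝ} (hρ : 0 ≤ ρ)
    (hr : |r| + ρ ≤ 1) (y : Cube n) : |recentre f x r ρ y| ≤ B := by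
  refine abs_multilinearExt_le hf fun j => (abs_add_le _ _).trans ?_
  rw [abs_mul, abs_mul, abs_unit_intCast, abs_unit_intCast, abs_of_nonneg hρ]
  linarith

theorem degree_recentre_le (hd : degree f ≤ d) (x : Cube n) (r ρ : ℝ) :
    degree (recentre f x r ρ) ≤ d := by
  rw [degree_le_iff] at hd ⊢
  intro T hT
  have hline : linePoly f T x = 0 := sum_eq_zero fun S hS => by
    rw [hd S (hT.trans_le (card_le_card (mem_filter.mp hS).2)), zero_mul, monomial_zero_right]
  rw [fourierCoeff_recentre, hline, eval_zero, mul_zero]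

/-- `B` bounds the level-`l` Fourier `ℓ₁`-norm of every function of degree at most `d` on the cube
with values in `[-1, 1]`. Quantifying over all such functions is what lets the induction on the
level apply the bound to `recentre f x r ρ`. -/
def IsLevelL1Bound (n d l : ℕ) (B : ℝ) : Prop :=
  ∀ f : Cube n → ℝ, (∀ x, |f x| ≤ 1) → degree f ≤ d → levelL1Norm f l ≤ B

theorem isLevelL1Bound_zero (n d : ℕ) : IsLevelL1Bound n d 0 1 := by
  intro f hf _
  rw [levelL1Norm, powersetCard_zero, sum_singleton, fourierCoeff_eq_expect]
  simpa [chi] using (abs_expect_le _ _).trans (expect_le univ_nonempty fun x _ => hf x)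

theorem IsLevelL1Bound.pow_mul_sum_abs_eval_linePoly_le (hB : IsLevelL1Bound n d l B)
    (hf : ∀ x, |f x| ≤ 1) (hd : degree f ≤ d) (x : Cube n) {r ρ : ℝ} (hρ : 0 ≤ ρ)
    (hr : |r| + ρ ≤ 1) : ρ ^ l * ∑ T ∈ univ.powersetCard l, |(linePoly f T x).eval r| ≤ B := by
  refine le_of_eq_of_le ?_ (hB _ (abs_recentre_le hf x hρ hr) (degree_recentre_le hd x r ρ))
  rw [levelL1Norm, mul_sum]
  refine sum_congr rfl fun T hT => ?_
  rw [fourierCoeff_recentre, abs_mul, abs_of_nonneg (pow_nonneg hρ _), (mem_powersetCard.mp hT).2]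

theorem IsLevelL1Bound.mul_sum_abs_coeff_one_linePoly_le (hB : IsLevelL1Bound n d l B)
    (hf : ∀ x, |f x| ≤ 1) (hd : degree f ≤ d) (x : Cube n) {ρ : ℝ} (hρ : ρ ∈ Set.Icc (0 : ℝ) 1) :
    (1 - ρ) * (ρ ^ l * ∑ T ∈ univ.powersetCard l, |(linePoly f T x).coeff 1|) ≤ d * B := by
  have hscale (a : ℝ) : ρ ^ l * |a| = |ρ ^ l * a| := by
    rw [abs_mul, abs_of_nonneg (pow_nonneg hρ.1 l)]
  have h := mul_sum_abs_coeff_one_le_mul_of_sum_abs_eval_le (s := univ.powersetCard l) (d := d)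
    (M := B) (p := fun T => C (ρ ^ l) * linePoly f T x) (sub_nonneg.mpr hρ.2)
    (fun T _ => (natDegree_C_mul_le _ _).trans (natDegree_linePoly_le hd T x)) fun r hr => by
      simp_rw [eval_mul, eval_C, ← hscale, ← mul_sum]
      exact hB.pow_mul_sum_abs_eval_linePoly_le hf hd x hρ.1 (by linarith)
  simpa only [coeff_C_mul, ← hscale, ← mul_sum] using h

theorem isLevelL1Bound_one (n d : ℕ) : IsLevelL1Bound n d 1 d := by
  intro f hf hd
  choose x hx using fun j => exists_unit_mul_eq_abs (fourierCoeff f {j})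
  have h := (isLevelL1Bound_zero n d).mul_sum_abs_coeff_one_linePoly_le hf hd x (ρ := 0) (by simp)
  have hcoeff : (linePoly f ∅ x).coeff 1 = levelL1Norm f 1 := by
    simp [coeff_one_linePoly, levelL1Norm, powersetCard_one, ← hx, mul_comm]
  rw [powersetCard_zero, sum_singleton, hcoeff, pow_zero, sub_zero, one_mul, one_mul, mul_one] at h
  exact (le_abs_self _).trans h

theorem IsLevelL1Bound.mul_levelL1Norm_succ_le (hB : IsLevelL1Bound n d l B)
    (hf : ∀ x, |f x| ≤ 1) (hd : degree f ≤ d) {ρ : ℝ} (hρ : ρ ∈ Set.Icc (0 : ℝ) 1) :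
    (1 - ρ) * (ρ ^ l * ((l + 1) * levelL1Norm f (l + 1))) ≤
      √n * Real.exp (1 / 2) * (d * B) := by
  have hρ0 := hρ.1
  have hρ1 := sub_nonneg.mpr hρ.2
  have hbern : (1 - ρ) * (ρ ^ l *
      𝔼 x, ∑ T ∈ univ.powersetCard l, |(linePoly f T x).coeff 1|) ≤ d * B := by
    simp_rw [mul_expect]
    exact expect_le univ_nonempty fun x _ => hB.mul_sum_abs_coeff_one_linePoly_le hf hd x hρ
  calc (1 - ρ) * (ρ ^ l * ((l + 1) * levelL1Norm f (l + 1)))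
      ≤ (1 - ρ) * (ρ ^ l * (√n * Real.exp (1 / 2) *
          𝔼 x, ∑ T ∈ univ.powersetCard l, |(linePoly f T x).coeff 1|)) := by
        gcongr (1 - ρ) * (ρ ^ l * ?_)
        exact mul_levelL1Norm_succ_le_expect f l
    _ = √n * Real.exp (1 / 2) * ((1 - ρ) * (ρ ^ l *
          𝔼 x, ∑ T ∈ univ.powersetCard l, |(linePoly f T x).coeff 1|)) := by ring
    _ ≤ √n * Real.exp (1 / 2) * (d * B) := by gcongr

theorem IsLevelL1Bound.succ (hB : IsLevelL1Bound n d l B) :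
    IsLevelL1Bound n d (l + 1) (√n * Real.exp (3 / 2) * (d * B)) := by
  intro f hf hd
  have hl : (0 : ℝ) < l + 1 := by positivity
  -- `ρ = l / (l + 1)` maximises `(1 - ρ) * ρ ^ l`.
  set ρ : ℝ := l / (l + 1) with hρ
  have hρl : (1 - ρ) * (l + 1) = 1 := by rw [hρ]; field_simp; ring
  have hnonneg : 0 ≤ levelL1Norm f (l + 1) := sum_nonneg fun _ _ => abs_nonneg _
  have hexp : Real.exp (3 / 2) = Real.exp 1 * Real.exp (1 / 2) := by
    rw [← Real.exp_add]
    norm_num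
  have hlevel : Real.exp (-1) * levelL1Norm f (l + 1) ≤ √n * Real.exp (1 / 2) * (d * B) :=
    calc Real.exp (-1) * levelL1Norm f (l + 1)
        ≤ ρ ^ l * levelL1Norm f (l + 1) := by
          gcongr
          exact exp_neg_one_le_div_succ_pow l
      _ = (1 - ρ) * (ρ ^ l * ((l + 1) * levelL1Norm f (l + 1))) := by
          linear_combination (-ρ ^ l * levelL1Norm f (l + 1)) * hρl
      _ ≤ √n * Real.exp (1 / 2) * (d * B) :=
          hB.mul_levelL1Norm_succ_le hf hd ⟨by positivity, (div_le_one hl).mpr (by linarith)⟩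
  rw [Real.exp_neg, inv_mul_le_iff₀ (Real.exp_pos 1)] at hlevel
  exact hlevel.trans_eq (by rw [hexp]; ring)

theorem isLevelL1Bound_of_one_le (n d : ℕ) (hl : 1 ≤ l) :
    IsLevelL1Bound n d l (d ^ l * (√n * Real.exp (3 / 2)) ^ (l - 1)) := by
  induction l, hl using Nat.le_induction with
  | base => simpa using isLevelL1Bound_one n d
  | succ l hl ih =>
    convert ih.succ using 1
    rw [← Nat.sub_add_cancel hl]
    simp only [Nat.add_sub_cancel]
    ring

end BooleanCube

theorem theorem2 (n d l : ℕ) (hl : 1 ≤ l) (f : BooleanCube.Cube n → ℝ)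
    (hf : ∀ x, f x ∈ Set.Icc (-1 : ℝ) 1) (hd : BooleanCube.degree f ≤ d) :
    BooleanCube.levelL1Norm f l ≤
      (n : ℝ) ^ (((l : ℝ) - 1) / 2) * (d : ℝ) ^ l * Real.exp ((Nat.choose (l + 1) 2 : ℕ) : ℝ) := by
  have hbound := BooleanCube.isLevelL1Bound_of_one_le n d hl f (fun x => abs_le.mpr (hf x)) hd
  have hsqrt : √(n : ℝ) ^ (l - 1) = (n : ℝ) ^ (((l : ℝ) - 1) / 2) := by
    rw [Real.sqrt_eq_rpow, ← Real.rpow_natCast, ← Real.rpow_mul n.cast_nonneg, Nat.cast_sub hl,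
      Nat.cast_one, one_div_mul_eq_div]
  have hexp : Real.exp (3 / 2) ^ (l - 1) ≤ Real.exp ((l + 1).choose 2 : ℕ) := by
    rw [← Real.exp_nat_mul, Nat.cast_sub hl, Nat.cast_one, mul_comm, Real.exp_le_exp]
    exact three_halves_mul_pred_le_choose_two l
  calc BooleanCube.levelL1Norm f l
      ≤ d ^ l * (√n * Real.exp (3 / 2)) ^ (l - 1) := hbound
    _ = √n ^ (l - 1) * d ^ l * Real.exp (3 / 2) ^ (l - 1) := by rw [mul_pow]; ring
    _ ≤ _ := by rw [hsqrt]; gcongr
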